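/- Let $R$ be a finite Frobenius ring, i.e. a finite ring with an additive character $\chi\colon R\to\mathbb{C}^\times$ whose kernel contains no nonzero left ideal, and let $\mathrm{w}(x)=1-\frac{1}{|R^\times|}\sum_{u\in R^\times}\chi(ux)$ be its homogeneous weight, extended to words by $\mathrm{w}(\mathbf{c})=\sum_j \mathrm{w}(c_j)$. A left linear code $C\le {}_RR^n$ without all-zero coordinate is called modular of index $r\in\mathbb{Q}$ if for a matrix $G=(\mathbf{g}_1|\dots|\mathbf{g}_n)\in R^{k\times n}$ with $C=\{\mathbf{x}G:\mathbf{x}\in R^k\}$ and every nonzero $\mathbf{g}\in R^k$ the number $|\{j:\mathbf{g}_jR=\mathbf{g}R\}|$ is either $0$ or $r\,|\mathbf{g}R^\times|$ (this does not depend on the choice of $G$ and $k$). Modular right linear codes are defined in the same way with left and right exchanged, using the rows of a matrix whose columns generate the code. A left or right linear code is a two-weight code with weights $w_1<w_2$ if the set of nonzero values of $\mathrm{w}$ on it is exactly $\{w_1,w_2\}$. Theorem. Let $C\le{}_RR^n$ be a modular two-weight code of index $r$ with weights $w_1<w_2$ such that $C_0=\{\mathbf{c}\in C:\mathrm{w}(\mathbf{c})=0\}=\{\mathbf{0}\}$.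 Let $b_1=|C_1|$ be the number of words in $C_1=\{\mathbf{c}\in C:\mathrm{w}(\mathbf{c})=w_1\}$, let $M_1\in R^{b_1\times n}$ be a matrix whose rows are the words of $C_1$ in some order, and let the dual $C'\le R^{b_1}_R$ be the right linear code generated by the columns of $M_1$. Then $C'$ is modular (of index $1$), $C'_0=\{\mathbf{c}\in C':\mathrm{w}(\mathbf{c})=0\}=\{\mathbf{0}\}$, and $C'$ is a two-weight code with weights $w_1'<w_2'$ given by $$w_1'=\frac{(w_2-n-r)|C|}{w_2-w_1}=\frac{b_1w_1}{n},\qquad w_2'=\frac{(w_2-n)|C|}{w_2-w_1}.$$ -/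

import Mathlib

namespace FrobCode

noncomputable section

variable {R : Type*} [Ring R]

/-- A generating character of `R`: an additive character `R → ℂˣ` whose kernel contains no
nonzero left ideal. A finite ring is a Frobenius ring iff it has such a character. -/
def IsGeneratingChar (χ : AddChar R ℂ) : Prop :=
  ∀ I : Ideal R, (∀ x ∈ I, χ x = 1) → I = ⊥

/-- The normalized homogeneous weight on a finite ring with generating character `χ`:
`w(x) = 1 - |Rˣ|⁻¹ ∑_{u ∈ Rˣ} χ(u x)`. -/
def homWeight (χ : AddChar R ℂ) (x : R) : ℂ :=
  1 - (Nat.card Rˣ : ℂ)⁻¹ * ∑ᶠ u : Rˣ, χ ((u : R) * x)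

/-- The homogeneous weight of a word, the sum of the weights of its entries. -/
def wordWeight (χ : AddChar R ℂ) {n : ℕ} (c : Fin n → R) : ℂ :=
  ∑ j, homWeight χ (c j)

/-- The words of weight `w` in `C`. -/
def weightClass (χ : AddChar R ℂ) {n : ℕ} (C : Set (Fin n → R)) (w : ℂ) : Set (Fin n → R) :=
  {c | c ∈ C ∧ wordWeight χ c = w}

/-- `C` has exactly two nonzero homogeneous weights, namely `w₁ < w₂`. -/
def IsTwoWeight (χ : AddChar R ℂ) {n : ℕ} (C : Set (Fin n → R)) (w₁ w₂ : ℝ) : Prop :=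
  w₁ < w₂ ∧ {w : ℂ | w ≠ 0 ∧ ∃ c ∈ C, wordWeight χ c = w} = {(w₁ : ℂ), (w₂ : ℂ)}

/-- The left linear code generated by the rows of `G`. -/
def rowCode {k n : ℕ} (G : Matrix (Fin k) (Fin n) R) : Submodule R (Fin n → R) :=
  Submodule.span R (Set.range fun i => G i)

/-- The right linear code generated by the columns of `H`; right `R`-modules are modules over
`Rᵐᵒᵖ`. -/
def colCode {m k : ℕ} (H : Matrix (Fin m) (Fin k) R) : Submodule Rᵐᵒᵖ (Fin m → R) :=
  Submodule.span Rᵐᵒᵖ (Set.range fun j => fun i => H i j)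

/-- The multiplicity `α(gR)`: the number of columns `g_j` of `G` with `g_j R = g R`. -/
def colMult {k n : ℕ} (G : Matrix (Fin k) (Fin n) R) (g : Fin k → R) : ℕ :=
  Nat.card {j : Fin n //
    Submodule.span Rᵐᵒᵖ {fun i => G i j} = Submodule.span Rᵐᵒᵖ {g}}

/-- The multiplicity `α(Rh)`: the number of rows `h_i` of `H` with `R h_i = R h`. -/
def rowMult {m k : ℕ} (H : Matrix (Fin m) (Fin k) R) (h : Fin k → R) : ℕ :=
  Nat.card {i : Fin m // Submodule.span R {H i} = Submodule.span R {h}}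

/-- The orbit `g Rˣ`. -/
def rightOrbit {k : ℕ} (g : Fin k → R) : Set (Fin k → R) :=
  Set.range fun u : Rˣ => fun i => g i * (u : R)

/-- The orbit `Rˣ h`. -/
def leftOrbit {k : ℕ} (h : Fin k → R) : Set (Fin k → R) :=
  Set.range fun u : Rˣ => fun i => (u : R) * h i

/-- The left linear code `C` (without all-zero coordinate) is modular of index `r`: for a
generator matrix `G`, every point `gR` of the projective geometry of the right module `R^k` has
multiplicity `0` or `r |g Rˣ|`. -/
def IsLeftModular {n : ℕ} (C : Submodule R (Fin n → R)) (r : ℚ) : Prop :=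
  (∀ j, ∃ c ∈ C, c j ≠ 0) ∧
  ∃ (k : ℕ) (G : Matrix (Fin k) (Fin n) R), rowCode G = C ∧
    ∀ g : Fin k → R, g ≠ 0 →
      colMult G g = 0 ∨ (colMult G g : ℚ) = r * (rightOrbit g).ncard

/-- The same notion for right linear codes, with rows and columns, left and right exchanged. -/
def IsRightModular {m : ℕ} (C : Submodule Rᵐᵒᵖ (Fin m → R)) (r : ℚ) : Prop :=
  (∀ i, ∃ c ∈ C, c i ≠ 0) ∧
  ∃ (k : ℕ) (H : Matrix (Fin m) (Fin k) R), colCode H = C ∧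
    ∀ h : Fin k → R, h ≠ 0 →
      rowMult H h = 0 ∨ (rowMult H h : ℚ) = r * (leftOrbit h).ncard

/-- The rows of `M` are the elements of `S`, each exactly once, in some order. -/
def RowsEnumerate {b n : ℕ} (M : Matrix (Fin b) (Fin n) R) (S : Set (Fin n → R)) : Prop :=
  (Function.Injective fun i => M i) ∧ (Set.range fun i => M i) = S

end

end FrobCode

/-!
The proof computes Fourier transforms on the finite group `C`. For `y ∈ Rⁿ` the functional
`c ↦ c · y` gives the character `c ↦ χ (c · y)` of `C`, which is trivial exactly when `y` is
orthogonal to `C`, because `χ` is a generating character. The words of the code generated by the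
columns of `M₁` are the `M₁ y`, and since `C₁` is stable under left multiplication by units, the
weight of `M₁ y` is `b₁ - ∑_{c ∈ C₁} χ (c · y)`: the weights of the dual code are read off from
the Fourier transform of the indicator function of `C₁`.

On `C` the weight takes only the values `0`, `w₁`, `w₂`, with `0` only at the zero word, so this
indicator function is a linear combination of `1`, the indicator function of `0` and the weight
(`IsGeneratingChar.sum_weightClass`). The transform of the weight, in turn, counts how often the
functional of `y` is a unit multiple of a coordinate function
(`IsGeneratingChar.sum_weight_mul`); this uses that the homogeneous weight is the same for left
and right multiplication by units (`IsGeneratingChar.sum_units_comm`). Modularity says that the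
count is `0` or `r |Rˣ|` (`IsLeftModular.coordCount_eq`), whence the two dual weights. The smaller
one is attained at the columns of `M₁`, which also gives its second form by double counting. The
larger one is attained because otherwise Fourier inversion would give `C` a single nonzero weight
(`IsGeneratingChar.exists_coordCount_eq_zero`).

The multiplicities in the definition of modularity refer to cyclic submodules, the counting to
orbits of units. They agree because generators of the same cyclic module over a finite ring
differ by a unit (`exists_unit_smul_eq`). This is derived from cancellation of finite modules in
direct sums (`nonempty_equiv_of_prod_equiv`), which follows by counting homomorphisms.
-/

namespace FrobCode

/-! ### Cancellation of finite modules -/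

section Cancellation

universe u

variable {R : Type*} [Ring R] {T A B B' : Type u}
  [AddCommGroup T] [Module R T] [AddCommGroup A] [Module R A]
  [AddCommGroup B] [Module R B] [AddCommGroup B'] [Module R B']

/-- Homomorphisms with a prescribed kernel `K` are the injective homomorphisms out of the
quotient by `K`. -/
def kerEqEquiv (K : Submodule R T) :
    {f : T →ₗ[R] B // LinearMap.ker f = K} ≃ {g : T ⧸ K →ₗ[R] B // Function.Injective g} where
  toFun f := ⟨K.liftQ f.1 f.2.ge, LinearMap.ker_eq_bot.1 (by
    rw [Submodule.ker_liftQ, f.2, Submodule.mkQ_map_self])⟩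
  invFun g := ⟨g.1 ∘ₗ K.mkQ, by
    rw [LinearMap.ker_comp, LinearMap.ker_eq_bot.2 g.2]
    exact Submodule.ker_mkQ K⟩
  left_inv f := by ext; simp
  right_inv g := by ext; simp

lemma card_linearMap_eq_sum [Finite T] [Finite B] [Fintype (Submodule R T)] :
    Nat.card (T →ₗ[R] B) =
      ∑ K : Submodule R T, Nat.card {g : T ⧸ K →ₗ[R] B // Function.Injective g} := by
  have : Finite (T →ₗ[R] B) := DFunLike.finite _
  rw [← Nat.card_congr (Equiv.sigmaFiberEquiv fun f : T →ₗ[R] B => LinearMap.ker f),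
    Nat.card_sigma]
  exact Finset.sum_congr rfl fun K _ => Nat.card_congr (kerEqEquiv K)

/-- Lovász's counting principle: if `B` and `B'` receive equally many homomorphisms from every
finite module, they receive equally many injective ones. -/
lemma card_injective_eq [Finite B] [Finite B']
    (h : ∀ (T : Type u) [AddCommGroup T] [Module R T] [Finite T],
      Nat.card (T →ₗ[R] B) = Nat.card (T →ₗ[R] B')) (n : ℕ) :
    ∀ (T : Type u) [AddCommGroup T] [Module R T] [Finite T], Nat.card T = n →
      Nat.card {g : T →ₗ[R] B // Function.Injective g} =
        Nat.card {g : T →ₗ[R] B' // Function.Injective g} := by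
  classical
  induction n using Nat.strong_induction_on with
  | _ n ih =>
    intro T _ _ _ hT
    have : Finite (Submodule R T) := inferInstance
    have := Fintype.ofFinite (Submodule R T)
    have ih' : ∀ K ∈ Finset.univ.erase (⊥ : Submodule R T),
        Nat.card {g : T ⧸ K →ₗ[R] B // Function.Injective g} =
          Nat.card {g : T ⧸ K →ₗ[R] B' // Function.Injective g} := by
      intro K hK
      have : Finite (T ⧸ K) := Finite.of_surjective _ K.mkQ_surjective
      refine ih (Nat.card (T ⧸ K)) ?_ (T ⧸ K) rfl
      have hK' : K ≠ ⊥ := Finset.ne_of_mem_erase hK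
      have h1 := Submodule.card_eq_card_quotient_mul_card K
      have h2 : 1 < Nat.card K := by
        have := (Submodule.nontrivial_iff_ne_bot).2 hK'
        exact Finite.one_lt_card
      have h3 : 0 < Nat.card (T ⧸ K) := Nat.card_pos
      rw [← hT, h1]
      nlinarith
    -- After removal of the terms which agree by induction, the two counts of all homomorphisms
    -- leave the term of the zero kernel.
    have key := h T
    rw [card_linearMap_eq_sum, card_linearMap_eq_sum,
      ← Finset.add_sum_erase _ _ (Finset.mem_univ (⊥ : Submodule R T)),
      ← Finset.add_sum_erase _ _ (Finset.mem_univ (⊥ : Submodule R T)),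
      Finset.sum_congr rfl fun K hK => ih' K hK] at key
    have e := Submodule.quotEquivOfEqBot (⊥ : Submodule R T) rfl
    have tr : ∀ (D : Type u) [AddCommGroup D] [Module R D],
        Nat.card {g : (T ⧸ (⊥ : Submodule R T)) →ₗ[R] D // Function.Injective g} =
          Nat.card {g : T →ₗ[R] D // Function.Injective g} := fun D _ _ =>
      Nat.card_congr
        { toFun := fun g => ⟨g.1 ∘ₗ e.symm.toLinearMap, g.2.comp e.symm.injective⟩
          invFun := fun g => ⟨g.1 ∘ₗ e.toLinearMap, g.2.comp e.injective⟩
          left_inv := fun g => by ext; simp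
          right_inv := fun g => by ext; simp }
    have := Nat.add_right_cancel key
    rwa [tr, tr] at this

/-- Finite modules can be cancelled from direct sums: `A` contributes the same factor to the number
of homomorphisms into `A × B` and into `A × B'`, so by the counting principle there is an injective
homomorphism `B → B'`, and `B`, `B'` are equally large. -/
lemma nonempty_equiv_of_prod_equiv [Finite A] [Finite B] [Finite B']
    (e : (A × B) ≃ₗ[R] (A × B')) : Nonempty (B ≃ₗ[R] B') := by
  have hom : ∀ (T : Type u) [AddCommGroup T] [Module R T] [Finite T],
      Nat.card (T →ₗ[R] B) = Nat.card (T →ₗ[R] B') := by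
    intro T _ _ _
    have : Finite (T →ₗ[R] A) := DFunLike.finite _
    have h : Nat.card (T →ₗ[R] (A × B)) = Nat.card (T →ₗ[R] (A × B')) :=
      Nat.card_congr
        { toFun := fun f => e.toLinearMap ∘ₗ f
          invFun := fun f => e.symm.toLinearMap ∘ₗ f
          left_inv := fun f => by ext x <;> simp
          right_inv := fun f => by ext x <;> simp }
    rw [← Nat.card_congr (LinearMap.prodEquiv ℕ (M := T) (M₂ := A) (M₃ := B) (R := R)).toEquiv,
      ← Nat.card_congr (LinearMap.prodEquiv ℕ (M := T) (M₂ := A) (M₃ := B') (R := R)).toEquiv,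
      Nat.card_prod, Nat.card_prod] at h
    exact Nat.eq_of_mul_eq_mul_left Nat.card_pos h
  have hcard : Nat.card B = Nat.card B' := by
    have h := Nat.card_congr e.toEquiv
    rw [Nat.card_prod, Nat.card_prod] at h
    exact Nat.eq_of_mul_eq_mul_left Nat.card_pos h
  have hinj := card_injective_eq hom _ B rfl
  have : Finite (B →ₗ[R] B) := DFunLike.finite _
  have : Finite (B →ₗ[R] B') := DFunLike.finite _
  have : Nonempty {g : B →ₗ[R] B // Function.Injective g} :=
    ⟨⟨LinearMap.id, Function.injective_id⟩⟩
  have hpos : 0 < Nat.card {g : B →ₗ[R] B' // Function.Injective g} := hinj ▸ Nat.card_pos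
  obtain ⟨⟨g, hg⟩⟩ := (Nat.card_pos_iff.1 hpos).1
  exact ⟨LinearEquiv.ofBijective g
    ((Nat.bijective_iff_injective_and_card g).2 ⟨hg, hcard⟩)⟩

/-- An isomorphism between direct summands of a finite module extends to an automorphism which
matches the given complements. -/
lemma exists_equiv_extending {M : Type u} [AddCommGroup M] [Module R M] [Finite M]
    {P Q P' Q' : Submodule R M} (h : IsCompl P Q) (h' : IsCompl P' Q') (α : P ≃ₗ[R] P') :
    ∃ θ : M ≃ₗ[R] M, (∀ x : P, θ x = α x) ∧ ∀ x ∈ Q, θ x ∈ Q' := by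
  obtain ⟨β⟩ := nonempty_equiv_of_prod_equiv
    ((Submodule.prodEquivOfIsCompl P Q h) ≪≫ₗ (Submodule.prodEquivOfIsCompl P' Q' h').symm ≪≫ₗ
      (LinearEquiv.prodCongr α.symm (LinearEquiv.refl R Q')))
  refine ⟨(Submodule.prodEquivOfIsCompl P Q h).symm ≪≫ₗ LinearEquiv.prodCongr α β ≪≫ₗ
    Submodule.prodEquivOfIsCompl P' Q' h', fun x => ?_, fun x hx => ?_⟩
  · simp
  · lift x to Q using hx
    simp

end Cancellation

/-! ### Generators of cyclic modules over finite rings -/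

section Units

variable {R : Type*} [Ring R]

lemma exists_isIdempotentElem_pow [Finite R] (c : R) :
    ∃ m : ℕ, IsIdempotentElem (c ^ (m + 1)) := by
  obtain ⟨i, j, hij, h⟩ := Finite.exists_ne_map_eq_of_infinite fun i : ℕ => c ^ (i + 1)
  wlog hlt : i < j generalizing i j
  · exact this j i hij.symm h.symm (by omega)
  obtain ⟨d, rfl⟩ := Nat.exists_eq_add_of_lt hlt
  -- The powers of `c` have period `d + 1` from the exponent `i + 1` on, so any multiple of the
  -- period which is at least `i + 1` is an idempotent exponent.
  have step : ∀ k s : ℕ, c ^ (i + 1 + s + k * (d + 1)) = c ^ (i + 1 + s) := by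
    intro k s
    induction k with
    | zero => simp
    | succ k ih =>
      rw [← ih, show i + 1 + s + (k + 1) * (d + 1) = (i + d + 1 + 1) + (s + k * (d + 1)) by ring,
        pow_add, ← h, ← pow_add]
      congr 1
      ring
  refine ⟨i * (d + 1) + d, ?_⟩
  have := step (i + 1) (i * d + d)
  rw [IsIdempotentElem, ← pow_add]
  convert this using 2 <;> ring

/-- The elements fixed by right multiplication by an idempotent `e`, that is, `R e`. -/
def fixedBy (e : R) : Submodule R R := LinearMap.ker (LinearMap.toSpanSingleton R R (e - 1))

/-- The left annihilator of `e`. -/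
def killedBy (e : R) : Submodule R R := LinearMap.ker (LinearMap.toSpanSingleton R R e)

lemma mem_fixedBy {e r : R} : r ∈ fixedBy e ↔ r * e = r := by
  simp [fixedBy, mul_sub, sub_eq_zero]

lemma mem_killedBy {e r : R} : r ∈ killedBy e ↔ r * e = 0 := by
  simp [killedBy]

lemma isCompl_fixedBy_killedBy {e : R} (he : IsIdempotentElem e) :
    IsCompl (fixedBy e) (killedBy e) := by
  rw [isCompl_iff, Submodule.disjoint_def, codisjoint_iff, eq_top_iff]
  refine ⟨fun x h1 h2 => ?_, fun x _ => ?_⟩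
  · rw [mem_fixedBy] at h1
    rw [mem_killedBy] at h2
    rw [← h1, h2]
  · rw [Submodule.mem_sup]
    refine ⟨x * e, mem_fixedBy.2 (by rw [mul_assoc, he.eq]), x - x * e, mem_killedBy.2 ?_, by simp⟩
    rw [sub_mul, mul_assoc, he.eq, sub_self]

/-- Over a finite ring, two generators of the same cyclic module differ by a unit. If `y = a x`
and `x = b y`, then a power `e` of `b a` is an idempotent fixing `x`, it factors as `e = b' a` such
that `f = a b'` is an idempotent fixing `y`, and multiplication by `a e` identifies `R f` with
`R e`; by cancellation this identification extends to
an automorphism of the left module `R`, which is right multiplication by a unit. -/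
lemma exists_unit_smul_eq [Finite R] {M : Type*} [AddCommGroup M] [Module R M] {x y : M}
    (h : Submodule.span R {x} = Submodule.span R {y}) : ∃ u : Rˣ, u • x = y := by
  obtain ⟨a, ha⟩ := Submodule.mem_span_singleton.1 (h ▸ Submodule.mem_span_singleton_self y)
  obtain ⟨b, hb⟩ := Submodule.mem_span_singleton.1 (h ▸ Submodule.mem_span_singleton_self x)
  obtain ⟨m, hm⟩ := exists_isIdempotentElem_pow (b * a)
  set e := (b * a) ^ (m + 1) with he
  -- The left factor `e` makes `b'` satisfy `e b' = b'`, so that `f = a b'` is idempotent.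
  set b' := e * ((b * a) ^ m * b) with hb'
  set f := a * b' with hf
  have heb' : e * b' = b' := by rw [hb', ← mul_assoc, hm.eq]
  have hba : b' * a = e := by
    rw [hb', mul_assoc, mul_assoc ((b * a) ^ m), ← pow_succ, ← he, hm.eq]
  have hf_idem : IsIdempotentElem f := by
    rw [IsIdempotentElem, hf, mul_assoc, ← mul_assoc b', hba, heb']
  have hfix : ∀ k, (b * a) ^ k • x = x := by
    intro k
    induction k with
    | zero => simp
    | succ k ih => rw [pow_succ, mul_smul, mul_smul, ha, hb, ih]
  have hex : e • x = x := hfix _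
  have hb'y : b' • y = x := by rw [hb', mul_smul, mul_smul, hb, hfix, hex]
  have hfy : f • y = y := by rw [hf, mul_smul, hb'y, ha]
  have hae : a * e = f * a := by rw [hf, mul_assoc, hba]
  have hbf : b' * f = b' := by rw [hf, ← mul_assoc, hba, heb']
  -- Right multiplication by `a e` and by `b'` are inverse bijections between `R f` and `R e`.
  let α : fixedBy f ≃ₗ[R] fixedBy e :=
    LinearEquiv.ofLinearMap
      (((LinearMap.toSpanSingleton R R (a * e)).domRestrict (fixedBy f)).codRestrict (fixedBy e)
        fun r => mem_fixedBy.2 (by simp [mul_assoc, hm.eq]))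
      (((LinearMap.toSpanSingleton R R b').domRestrict (fixedBy e)).codRestrict (fixedBy f)
        fun r => mem_fixedBy.2 (by simp [mul_assoc, hbf]))
      (by
        ext ⟨r, hr⟩
        simp [mul_assoc, ← mul_assoc b', hba, hm.eq, mem_fixedBy.1 hr])
      (by
        ext ⟨r, hr⟩
        simp [mul_assoc, heb', ← hf, mem_fixedBy.1 hr])
  obtain ⟨θ, hθ, hθ'⟩ := exists_equiv_extending (isCompl_fixedBy_killedBy hf_idem)
    (isCompl_fixedBy_killedBy hm) α
  have hθmul : ∀ r, θ r = r * θ 1 := fun r => by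
    rw [← smul_eq_mul, ← map_smul, smul_eq_mul, mul_one]
  have hθinv : ∀ r, θ.symm r = r * θ.symm 1 := fun r => by
    rw [← smul_eq_mul, ← map_smul, smul_eq_mul, mul_one]
  refine ⟨⟨θ 1, θ.symm 1, by rw [← hθinv, θ.symm_apply_apply],
    by rw [← hθmul, θ.apply_symm_apply]⟩, ?_⟩
  have h1 : θ f = a * e := by
    have := hθ ⟨f, mem_fixedBy.2 hf_idem.eq⟩
    rw [this]
    simp [α, hae, ← mul_assoc, hf_idem.eq]
  have h2 : θ (1 - f) • x = 0 := by
    have := mem_killedBy.1 (hθ' (1 - f) (mem_killedBy.2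
      (by rw [sub_mul, one_mul, hf_idem.eq, sub_self])))
    rw [← hex, ← mul_smul, this, zero_smul]
  change θ 1 • x = y
  rw [map_sub, sub_smul, sub_eq_zero, h1, mul_smul, hex, ha] at h2
  exact h2

end Units

open Finset Matrix

/-! ### Generating characters and the homogeneous weight -/

section Character

variable {R : Type*} [Ring R] {χ : AddChar R ℂ}

lemma IsGeneratingChar.eq_zero_of_left (hχ : IsGeneratingChar χ) {a : R}
    (h : ∀ r, χ (r * a) = 1) : a = 0 := by
  have := hχ (Ideal.span {a}) fun x hx => by
    obtain ⟨r, rfl⟩ := Ideal.mem_span_singleton'.1 hx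
    exact h r
  simpa using this

lemma IsGeneratingChar.eq_of_left (hχ : IsGeneratingChar χ) {a b : R}
    (h : ∀ r, χ (r * a) = χ (r * b)) : a = b := by
  refine sub_eq_zero.1 (hχ.eq_zero_of_left fun r => ?_)
  rw [mul_sub, AddChar.map_sub_eq_div, h, div_self (χ.val_isUnit _).ne_zero]

variable [Fintype R]

/-- Every character of `R` is a translate of a generating character: `a ↦ χ(· a)` is injective
and `R` has exactly `|R|` characters. -/
lemma IsGeneratingChar.exists_eq (hχ : IsGeneratingChar χ) (ψ : AddChar R ℂ) :
    ∃ a, ∀ r, ψ r = χ (r * a) := by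
  let F : R → AddChar R ℂ := fun a => χ.compAddMonoidHom (AddMonoidHom.mulRight a)
  have hF : Function.Injective F := fun a b hab =>
    hχ.eq_of_left fun r => DFunLike.congr_fun hab r
  obtain ⟨a, ha⟩ := ((Fintype.bijective_iff_injective_and_card F).2 ⟨hF, by simp⟩).2 ψ
  exact ⟨a, fun r => by rw [← ha]; rfl⟩

/-- The kernel of a generating character contains no nonzero right ideal either: a right ideal
`a R` in the kernel is killed by every character of `R`. -/
lemma IsGeneratingChar.eq_zero_of_right (hχ : IsGeneratingChar χ) {a : R}
    (h : ∀ r, χ (a * r) = 1) : a = 0 :=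
  AddChar.forall_apply_eq_zero.1 fun ψ => by
    obtain ⟨b, hb⟩ := hχ.exists_eq ψ
    rw [hb, h]

variable [DecidableEq R]

lemma homWeight_eq_sum (x : R) :
    homWeight χ x = 1 - (Fintype.card Rˣ : ℂ)⁻¹ * ∑ u : Rˣ, χ (u * x) := by
  rw [homWeight, finsum_eq_sum_of_fintype, Nat.card_eq_fintype_card]

lemma card_units_ne_zero : (Fintype.card Rˣ : ℂ) ≠ 0 :=
  Nat.cast_ne_zero.2 Fintype.card_ne_zero

@[simp]
lemma homWeight_zero : homWeight χ 0 = 0 := by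
  simp [homWeight_eq_sum]

lemma homWeight_units_mul (v : Rˣ) (x : R) : homWeight χ (v * x) = homWeight χ x := by
  rw [homWeight_eq_sum, homWeight_eq_sum]
  congr 2
  exact Fintype.sum_equiv (Equiv.mulRight v) _ _ fun u => by simp [mul_assoc]

lemma homWeight_re_nonneg (x : R) : 0 ≤ (homWeight χ x).re := by
  have h1 : (∑ u : Rˣ, χ (u * x)).re ≤ Fintype.card Rˣ := by
    refine (Complex.re_le_norm _).trans ((norm_sum_le _ _).trans ?_)
    simp
  have h2 : (0 : ℝ) < Fintype.card Rˣ := Nat.cast_pos.2 Fintype.card_pos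
  have h3 : ((Fintype.card Rˣ : ℂ)⁻¹ * ∑ u : Rˣ, χ (u * x)).re =
      (Fintype.card Rˣ : ℝ)⁻¹ * (∑ u : Rˣ, χ (u * x)).re := by
    rw [← Complex.ofReal_natCast, ← Complex.ofReal_inv, Complex.re_ofReal_mul]
  rw [homWeight_eq_sum, Complex.sub_re, h3, Complex.one_re, sub_nonneg, inv_mul_le_iff₀ h2]
  simpa using h1

/-- The homogeneous weight is the same for left and right multiplication by units. The Nakayama
automorphism `σ`, defined by `χ(x y) = χ(y σ(x))`, permutes the units. -/
lemma IsGeneratingChar.sum_units_comm (hχ : IsGeneratingChar χ) (x : R) :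
    ∑ u : Rˣ, χ (u * x) = ∑ u : Rˣ, χ (x * u) := by
  choose σ hσ using fun a => hχ.exists_eq (χ.mulShift a)
  simp only [AddChar.mulShift_apply] at hσ
  let τ : R →* R :=
    { toFun := σ
      map_one' := hχ.eq_of_left fun r => by rw [← hσ, one_mul, mul_one]
      map_mul' := fun a b => hχ.eq_of_left fun r => by
        rw [← hσ, mul_assoc, hσ, mul_assoc, hσ, mul_assoc] }
  have hτ : Function.Injective (Units.map τ) := by
    refine Units.map_injective fun a b hab => sub_eq_zero.1 (hχ.eq_zero_of_right fun r => ?_)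
    have hab' : σ a = σ b := hab
    rw [sub_mul, AddChar.map_sub_eq_div, hσ a, hσ b, hab', div_self (χ.val_isUnit _).ne_zero]
  exact Fintype.sum_bijective _ (Finite.injective_iff_bijective.1 hτ) _ _ fun u => hσ _ _

lemma IsGeneratingChar.homWeight_eq (hχ : IsGeneratingChar χ) (x : R) :
    homWeight χ x = 1 - (Fintype.card Rˣ : ℂ)⁻¹ * ∑ u : Rˣ, χ (-(x * u)) := by
  rw [homWeight_eq_sum, hχ.sum_units_comm]
  congr 2
  exact Fintype.sum_equiv (Equiv.neg _) _ _ fun u => by simp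

end Character

/-! ### Fourier transforms on a linear code -/

section Transform

variable {R : Type*} [Ring R] {n : ℕ}

/-- `y` is orthogonal to the left linear code `C`, with respect to the standard bilinear form. -/
def IsPerp (C : Submodule R (Fin n → R)) (y : Fin n → R) : Prop := ∀ c ∈ C, c ⬝ᵥ y = 0

lemma isPerp_zero (C : Submodule R (Fin n → R)) : IsPerp C 0 := fun c _ => dotProduct_zero c

variable [Fintype R] {χ : AddChar R ℂ}

open Classical in
/-- Orthogonality on a left linear code: the values `c · y` form a left ideal, which lies in the
kernel of `χ` only if it is zero. -/
lemma IsGeneratingChar.sum_code (hχ : IsGeneratingChar χ) (C : Submodule R (Fin n → R))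
    (y : Fin n → R) :
    ∑ c : C, χ ((c : Fin n → R) ⬝ᵥ y) = if IsPerp C y then (Fintype.card C : ℂ) else 0 := by
  let f : C →+ R :=
    { toFun := fun c => (c : Fin n → R) ⬝ᵥ y
      map_zero' := by simp
      map_add' := by simp [add_dotProduct] }
  have := AddChar.sum_eq_ite (χ.compAddMonoidHom f)
  refine this.trans (if_congr ⟨fun h c hc => ?_, fun h => ?_⟩ rfl rfl)
  · refine hχ.eq_zero_of_left fun r => ?_
    have h2 := DFunLike.congr_fun h ⟨r • c, C.smul_mem r hc⟩
    simpa [f, smul_dotProduct] using h2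
  · ext c
    simp [f, h c c.2]

variable [DecidableEq R]

/-- Orthogonality on the whole space; here the entries of `c` generate right ideals. -/
lemma IsGeneratingChar.sum_space (hχ : IsGeneratingChar χ) (c : Fin n → R) :
    ∑ y : Fin n → R, χ (c ⬝ᵥ y) = if c = 0 then (Fintype.card (Fin n → R) : ℂ) else 0 := by
  classical
  let f : (Fin n → R) →+ R :=
    { toFun := fun y => c ⬝ᵥ y
      map_zero' := by simp
      map_add' := by simp [dotProduct_add] }
  have := AddChar.sum_eq_ite (χ.compAddMonoidHom f)
  refine this.trans (if_congr ⟨fun h => funext fun j => ?_, fun h => ?_⟩ rfl rfl)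
  · refine hχ.eq_zero_of_right fun r => ?_
    simpa [f] using DFunLike.congr_fun h (Pi.single j r)
  · ext y
    simp [f, h]

open Classical in
/-- The number of pairs `(j, u)` for which `y` acts on `C` as the `j`-th coordinate followed by
right multiplication by the unit `u`. -/
noncomputable def coordCount (C : Submodule R (Fin n → R)) (y : Fin n → R) : ℕ :=
  #{p : Fin n × Rˣ | IsPerp C (y - Pi.single p.1 (p.2 : R))}

open Classical in
/-- The Fourier transform of the homogeneous weight on a linear code. -/
lemma IsGeneratingChar.sum_weight_mul (hχ : IsGeneratingChar χ) (C : Submodule R (Fin n → R))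
    (y : Fin n → R) :
    ∑ c : C, wordWeight χ (c : Fin n → R) * χ ((c : Fin n → R) ⬝ᵥ y) =
      Fintype.card C * ((if IsPerp C y then (n : ℂ) else 0) -
        coordCount C y / Fintype.card Rˣ) := by
  have h1 : ∀ c : C, wordWeight χ (c : Fin n → R) * χ ((c : Fin n → R) ⬝ᵥ y) =
      n * χ ((c : Fin n → R) ⬝ᵥ y) - (Fintype.card Rˣ : ℂ)⁻¹ *
        ∑ p : Fin n × Rˣ, χ ((c : Fin n → R) ⬝ᵥ (y - Pi.single p.1 (p.2 : R))) := by
    intro c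
    simp only [wordWeight, hχ.homWeight_eq, sum_sub_distrib, ← mul_sum, sub_mul,
      Fintype.sum_prod_type, dotProduct_sub, dotProduct_single, sub_eq_add_neg (_ ⬝ᵥ _),
      AddChar.map_add_eq_mul, mul_assoc, sum_mul, mul_comm (χ (_ ⬝ᵥ _))]
    simp
  simp only [h1, sum_sub_distrib, ← mul_sum]
  rw [sum_comm, hχ.sum_code]
  simp only [hχ.sum_code]
  rw [← sum_filter, sum_const, coordCount, nsmul_eq_mul]
  split_ifs <;> ring

end Transform

/-! ### Modular codes -/

section Modular

variable {R : Type*} [Ring R] {n k : ℕ}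

lemma isPerp_rowCode (G : Matrix (Fin k) (Fin n) R) (y : Fin n → R) :
    IsPerp (rowCode G) y ↔ G *ᵥ y = 0 := by
  refine ⟨fun h => funext fun i => h _ (Submodule.subset_span ⟨i, rfl⟩), fun h c hc => ?_⟩
  induction hc using Submodule.span_induction with
  | mem c hc => obtain ⟨i, rfl⟩ := hc; exact congr_fun h i
  | zero => simp
  | add a b _ _ ha hb => rw [add_dotProduct, ha, hb, add_zero]
  | smul r a _ ha => rw [smul_dotProduct, ha, smul_zero]

lemma exists_units_of_span_op_eq [Finite R] {g h : Fin k → R}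
    (H : Submodule.span Rᵐᵒᵖ {g} = Submodule.span Rᵐᵒᵖ {h}) :
    ∃ u : Rˣ, (fun i => g i * u) = h := by
  have : Finite Rᵐᵒᵖ := Finite.of_equiv _ MulOpposite.opEquiv
  obtain ⟨u, hu⟩ := exists_unit_smul_eq H
  exact ⟨(Units.opEquiv u).unop, hu⟩

lemma span_op_mul_units (g : Fin k → R) (u : Rˣ) :
    Submodule.span Rᵐᵒᵖ {fun i => g i * (u : R)} = Submodule.span Rᵐᵒᵖ {g} :=
  Submodule.span_singleton_group_smul_eq Rᵐᵒᵖ (Units.opEquiv.symm (MulOpposite.op u)) g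

lemma span_op_eq_iff [Finite R] {g h : Fin k → R} :
    Submodule.span Rᵐᵒᵖ {g} = Submodule.span Rᵐᵒᵖ {h} ↔ g ∈ rightOrbit h := by
  refine ⟨fun H => exists_units_of_span_op_eq H.symm, ?_⟩
  rintro ⟨u, rfl⟩
  exact span_op_mul_units h u

lemma span_eq_iff [Finite R] {g h : Fin k → R} :
    Submodule.span R {g} = Submodule.span R {h} ↔ g ∈ leftOrbit h := by
  refine ⟨fun H => exists_unit_smul_eq H.symm, ?_⟩
  rintro ⟨u, rfl⟩
  exact Submodule.span_singleton_group_smul_eq R u h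

variable [Fintype R] [DecidableEq R]

/-- Both sides count the pairs `(j, u)` with `g_j u` in the orbit of `g`; all points of the orbit
are hit equally often. -/
lemma colMult_mul_card_units (G : Matrix (Fin k) (Fin n) R) (g : Fin k → R) :
    colMult G g * Fintype.card Rˣ =
      (rightOrbit g).ncard * #{p : Fin n × Rˣ | (fun i => G i p.1 * (p.2 : R)) = g} := by
  classical
  have h1 : colMult G g * Fintype.card Rˣ =
      #{p : Fin n × Rˣ | (fun i => G i p.1 * (p.2 : R)) ∈ (rightOrbit g).toFinset} := by
    rw [colMult, ← Nat.card_eq_fintype_card, ← Nat.card_prod, ← Fintype.card_subtype,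
      ← Nat.card_eq_fintype_card]
    refine Nat.card_congr
      { toFun := fun p => ⟨(p.1.1, p.2), ?_⟩
        invFun := fun p => (⟨p.1.1, ?_⟩, p.1.2)
        left_inv := fun p => rfl
        right_inv := fun p => rfl }
    · rw [Set.mem_toFinset, ← span_op_eq_iff, span_op_mul_units, p.1.2]
    · have := p.2
      rwa [Set.mem_toFinset, ← span_op_eq_iff, span_op_mul_units] at this
  rw [h1, card_eq_sum_card_fiberwise (t := (rightOrbit g).toFinset)
      (f := fun p : Fin n × Rˣ => (fun i => G i p.1 * (p.2 : R))) (fun p hp => by simpa using hp),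
    Set.ncard_eq_toFinset_card', ← smul_eq_mul, ← sum_const]
  refine sum_congr rfl fun h hh => ?_
  obtain ⟨v, rfl⟩ := Set.mem_toFinset.1 hh
  refine card_bij' (fun p _ => (p.1, p.2 * v⁻¹)) (fun p _ => (p.1, p.2 * v)) ?_ ?_ ?_ ?_
  · intro p hp
    have := (mem_filter.1 hp).2
    simp only [mem_filter, mem_univ, true_and, Units.val_mul, ← mul_assoc]
    funext i
    rw [congr_fun this i, Units.mul_inv_cancel_right]
  · intro p hp
    have hp := (mem_filter.1 hp).2
    have : (fun i => G i p.1 * ((p.2 * v : Rˣ) : R)) = fun i => g i * (v : R) := by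
      funext i
      rw [← hp, Units.val_mul, mul_assoc]
    simp only [mem_filter, mem_univ, true_and, Set.mem_toFinset]
    exact ⟨by rw [this]; exact ⟨v, rfl⟩, this⟩
  · simp
  · simp

/-- In a modular code of index `r`, the coordinate functions together with their unit multiples
cover a functional on `C` either not at all or `r |Rˣ|` times. -/
lemma IsLeftModular.coordCount_eq {C : Submodule R (Fin n → R)} {r : ℚ} (h : IsLeftModular C r)
    (y : Fin n → R) : coordCount C y = 0 ∨ (coordCount C y : ℚ) = r * Fintype.card Rˣ := by
  classical
  obtain ⟨h0, k, G, rfl, hG⟩ := h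
  have hcc : coordCount (rowCode G) y =
      #{p : Fin n × Rˣ | (fun i => G i p.1 * (p.2 : R)) = G *ᵥ y} := by
    rw [coordCount]
    congr 1
    ext p
    simp only [mem_filter, mem_univ, true_and, isPerp_rowCode, mulVec_sub, sub_eq_zero,
      mulVec_single]
    exact eq_comm
  by_cases hne : coordCount (rowCode G) y = 0
  · exact Or.inl hne
  refine Or.inr ?_
  have horb := colMult_mul_card_units G (G *ᵥ y)
  rw [← hcc] at horb
  have hopos : 0 < (rightOrbit (G *ᵥ y)).ncard :=
    (Set.ncard_pos (Set.toFinite _)).2 ⟨_, 1, rfl⟩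
  have hmult : colMult G (G *ᵥ y) ≠ 0 := fun h => by
    rw [h, zero_mul, eq_comm, mul_eq_zero] at horb
    omega
  have hy : G *ᵥ y ≠ 0 := by
    rw [hcc] at hne
    obtain ⟨⟨j, u⟩, hp⟩ := card_pos.1 (Nat.pos_of_ne_zero hne)
    have hp := (mem_filter.1 hp).2
    intro hzero
    rw [hzero] at hp
    obtain ⟨c, hc, hcj⟩ := h0 j
    have hperp : IsPerp (rowCode G) (Pi.single j 1) := by
      rw [isPerp_rowCode]
      funext i
      have := congr_fun hp i
      simpa using this
    exact hcj (by simpa using hperp c hc)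
  have hr := (hG _ hy).resolve_left hmult
  have horb' : (colMult G (G *ᵥ y) : ℚ) * Fintype.card Rˣ =
      (rightOrbit (G *ᵥ y)).ncard * coordCount (rowCode G) y := by exact_mod_cast horb
  rw [hr] at horb'
  have : ((rightOrbit (G *ᵥ y)).ncard : ℚ) ≠ 0 := by exact_mod_cast hopos.ne'
  refine mul_left_cancel₀ this ?_
  rw [← horb']
  ring

end Modular

/-! ### The dual code -/

section Dual

variable {R : Type*} [Ring R] {n b : ℕ}

lemma mem_colCode {M : Matrix (Fin b) (Fin n) R} {v : Fin b → R} :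
    v ∈ colCode M ↔ ∃ y : Fin n → R, M *ᵥ y = v := by
  rw [colCode, Submodule.mem_span_range_iff_exists_fun]
  refine ⟨fun ⟨c, hc⟩ => ⟨fun j => (c j).unop, ?_⟩, fun ⟨y, hy⟩ => ⟨fun j => .op (y j), ?_⟩⟩
  · rw [← hc]
    funext i
    simp [mulVec, dotProduct]
  · rw [← hy]
    funext i
    simp [mulVec, dotProduct]

variable {χ : AddChar R ℂ} {C : Submodule R (Fin n → R)}

/-- The weight of a word of the dual code is a sum over the words of the given weight. -/
lemma RowsEnumerate.wordWeight_mulVec {M : Matrix (Fin b) (Fin n) R} {w : ℂ}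
    [Fintype C] [DecidablePred fun c : C => wordWeight χ (c : Fin n → R) = w]
    (hM : RowsEnumerate M (weightClass χ (C : Set (Fin n → R)) w)) (y : Fin n → R) :
    wordWeight χ (M *ᵥ y) =
      ∑ c ∈ ({c | wordWeight χ (c : Fin n → R) = w} : Finset C),
        homWeight χ ((c : Fin n → R) ⬝ᵥ y) := by
  have hmem : ∀ i, M i ∈ weightClass χ (C : Set (Fin n → R)) w := fun i => hM.2 ▸ ⟨i, rfl⟩
  rw [wordWeight]
  refine sum_bij (fun i _ => ⟨M i, (hmem i).1⟩) (fun i _ => by simpa using (hmem i).2)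
    (fun i _ j _ h => hM.1 (congrArg Subtype.val h)) (fun c hc => ?_) (fun i _ => rfl)
  have : (c : Fin n → R) ∈ weightClass χ (C : Set (Fin n → R)) w :=
    ⟨c.2, (mem_filter.1 hc).2⟩
  rw [← hM.2] at this
  obtain ⟨i, hi⟩ := this
  exact ⟨i, mem_univ _, Subtype.ext hi⟩

variable [Fintype R] [DecidableEq R]

@[simp]
lemma wordWeight_zero : wordWeight χ (0 : Fin n → R) = 0 := by simp [wordWeight]

lemma wordWeight_units_smul (u : Rˣ) (c : Fin n → R) :
    wordWeight χ ((u : R) • c) = wordWeight χ c := by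
  simp [wordWeight, homWeight_units_mul]

lemma wordWeight_re_nonneg (c : Fin n → R) : 0 ≤ (wordWeight χ c).re := by
  rw [wordWeight, Complex.re_sum]
  exact sum_nonneg fun j _ => homWeight_re_nonneg _

open Classical in
/-- The words of a given weight are permuted by the units, so that averaging over the units does
not change their character sum. The number of these words is written as the character sum at `0`,
so that both terms are covered by one formula for the Fourier transform. -/
lemma sum_weightClass_homWeight (w : ℂ) (y : Fin n → R) :
    ∑ c ∈ ({c | wordWeight χ (c : Fin n → R) = w} : Finset C),
      homWeight χ ((c : Fin n → R) ⬝ᵥ y) =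
      ∑ c ∈ ({c | wordWeight χ (c : Fin n → R) = w} : Finset C), χ ((c : Fin n → R) ⬝ᵥ 0) -
        ∑ c ∈ ({c | wordWeight χ (c : Fin n → R) = w} : Finset C), χ ((c : Fin n → R) ⬝ᵥ y) := by
  have h : ∀ u : Rˣ,
      ∑ c ∈ ({c | wordWeight χ (c : Fin n → R) = w} : Finset C), χ (u * ((c : Fin n → R) ⬝ᵥ y)) =
        ∑ c ∈ ({c | wordWeight χ (c : Fin n → R) = w} : Finset C), χ ((c : Fin n → R) ⬝ᵥ y) := by
    intro u
    rw [sum_filter, sum_filter]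
    refine Fintype.sum_equiv (MulAction.toPerm u : Equiv.Perm C) _ _ fun c => ?_
    have hc : (((MulAction.toPerm u : Equiv.Perm C) c : C) : Fin n → R) =
        (u : R) • (c : Fin n → R) := rfl
    rw [hc, wordWeight_units_smul, smul_dotProduct, smul_eq_mul]
  simp only [homWeight_eq_sum, sum_sub_distrib, ← mul_sum]
  rw [sum_comm]
  simp [h]

open Classical in
/-- If `w₁` and `w₂` are the only weights of nonzero words, then on `C` the indicator function of
the words of weight `w₁` is a linear combination of `1`, the indicator function of `0` and the
weight; this determines its Fourier transform. -/
lemma IsGeneratingChar.sum_weightClass (hχ : IsGeneratingChar χ) {w₁ w₂ : ℂ} (hw₁ : w₁ ≠ 0)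
    (hC : ∀ c ∈ C, c ≠ 0 → wordWeight χ c = w₁ ∨ wordWeight χ c = w₂) (y : Fin n → R) :
    (w₂ - w₁) * ∑ c ∈ ({c | wordWeight χ (c : Fin n → R) = w₁} : Finset C),
      χ ((c : Fin n → R) ⬝ᵥ y) =
      (w₂ * if IsPerp C y then (Fintype.card C : ℂ) else 0) - w₂ -
        Fintype.card C * ((if IsPerp C y then (n : ℂ) else 0) -
          coordCount C y / Fintype.card Rˣ) := by
  -- Both sides are sums over `C`, in which the lone `w₂` is the contribution of the zero word.
  have h0 : w₂ = ∑ c : C, if c = 0 then w₂ else 0 := by simp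
  rw [← hχ.sum_weight_mul, ← hχ.sum_code, mul_sum, mul_sum, sum_filter]
  nth_rewrite 3 [h0]
  rw [← sum_sub_distrib, ← sum_sub_distrib]
  refine sum_congr rfl fun c _ => ?_
  by_cases hc : c = 0
  · simp [hc, hw₁.symm]
  · have hc' : (c : Fin n → R) ≠ 0 := fun h => hc (Subtype.ext h)
    rw [if_neg hc]
    by_cases h1 : wordWeight χ (c : Fin n → R) = w₁
    · rw [if_pos h1, h1]
      ring
    · rw [if_neg h1, (hC c c.2 hc').resolve_left h1]
      ring

lemma coordCount_eq_zero_of_isPerp (h0 : ∀ j, ∃ c ∈ C, c j ≠ 0) {y : Fin n → R}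
    (hy : IsPerp C y) : coordCount C y = 0 := by
  classical
  rw [coordCount, card_eq_zero, filter_eq_empty_iff]
  rintro ⟨j, u⟩ - hp
  obtain ⟨c, hc, hcj⟩ := h0 j
  have := hp c hc
  rw [dotProduct_sub, hy c hc, zero_sub, neg_eq_zero, dotProduct_single] at this
  exact hcj ((Units.mul_left_eq_zero u).1 this)

lemma coordCount_single_ne_zero (j : Fin n) : coordCount C (Pi.single j 1) ≠ 0 := by
  classical
  rw [coordCount]
  refine (card_pos.2 ⟨(j, 1), ?_⟩).ne'
  simp [isPerp_zero]

open Classical in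
/-- The weights of the words of the dual code, up to the factor `w₂ - w₁`. -/
lemma IsGeneratingChar.sum_weightClass_dual (hχ : IsGeneratingChar χ) {w₁ w₂ : ℂ} (hw₁ : w₁ ≠ 0)
    (hC : ∀ c ∈ C, c ≠ 0 → wordWeight χ c = w₁ ∨ wordWeight χ c = w₂)
    (h0 : ∀ j, ∃ c ∈ C, c j ≠ 0) (y : Fin n → R) :
    (w₂ - w₁) * ∑ c ∈ ({c | wordWeight χ (c : Fin n → R) = w₁} : Finset C),
      homWeight χ ((c : Fin n → R) ⬝ᵥ y) =
      (if IsPerp C y then 0 else (w₂ - n) * Fintype.card C) -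
        Fintype.card C * (coordCount C y / Fintype.card Rˣ) := by
  rw [sum_weightClass_homWeight, mul_sub, hχ.sum_weightClass hw₁ hC, hχ.sum_weightClass hw₁ hC,
    coordCount_eq_zero_of_isPerp h0 (isPerp_zero C), if_pos (isPerp_zero C),
    if_pos (isPerp_zero C)]
  split_ifs <;> push_cast <;> ring

/-- If the unit multiples of the coordinate functions exhausted the nonzero functionals on a
modular code, the Fourier transform of its weight would only depend on whether it is taken at a
zero functional; by Fourier inversion the code would have a single nonzero weight. -/
lemma IsGeneratingChar.exists_coordCount_eq_zero (hχ : IsGeneratingChar χ) {r : ℚ}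
    (hmod : IsLeftModular C r) {c₁ c₂ : Fin n → R} (h₁ : c₁ ∈ C) (h₂ : c₂ ∈ C) (h₁0 : c₁ ≠ 0)
    (h₂0 : c₂ ≠ 0) (hne : wordWeight χ c₁ ≠ wordWeight χ c₂) :
    ∃ y, ¬ IsPerp C y ∧ coordCount C y = 0 := by
  classical
  by_contra! H
  have hU : (Fintype.card Rˣ : ℂ) ≠ 0 := card_units_ne_zero
  have hhat : ∀ y, ∑ c : C, wordWeight χ (c : Fin n → R) * χ ((c : Fin n → R) ⬝ᵥ y) =
      (if IsPerp C y then Fintype.card C * ((n : ℂ) + r) else 0) - r * Fintype.card C := by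
    intro y
    rw [hχ.sum_weight_mul]
    by_cases hy : IsPerp C y
    · rw [if_pos hy, if_pos hy, coordCount_eq_zero_of_isPerp hmod.1 hy]
      push_cast
      ring
    · have := (hmod.coordCount_eq y).resolve_left (H y hy)
      have : (coordCount C y : ℂ) = r * Fintype.card Rˣ := by exact_mod_cast this
      rw [if_neg hy, if_neg hy, this, mul_div_cancel_right₀ _ hU]
      ring
  have key : ∀ a ∈ C, a ≠ 0 → (Fintype.card (Fin n → R) : ℂ) * wordWeight χ a =
      ∑ y : Fin n → R, if IsPerp C y then Fintype.card C * ((n : ℂ) + r) else 0 := by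
    intro a ha ha0
    -- Fourier inversion at the word `a`.
    have e1 : ∑ y : Fin n → R, (∑ c : C, wordWeight χ (c : Fin n → R) *
        χ ((c : Fin n → R) ⬝ᵥ y)) * χ ((-a) ⬝ᵥ y) = Fintype.card (Fin n → R) * wordWeight χ a := by
      simp only [sum_mul, mul_assoc, ← AddChar.map_add_eq_mul, ← add_dotProduct]
      rw [sum_comm]
      simp only [← mul_sum, hχ.sum_space, add_neg_eq_zero]
      rw [sum_eq_single (⟨a, ha⟩ : C)]
      · simp [mul_comm]
      · intro c _ hc
        rw [if_neg fun h => hc (Subtype.ext h), mul_zero]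
      · simp
    rw [← e1]
    simp only [hhat, sub_mul, sum_sub_distrib, ← mul_sum, hχ.sum_space]
    rw [if_neg (neg_ne_zero.2 ha0), mul_zero, sub_zero]
    refine sum_congr rfl fun y _ => ?_
    split_ifs with hy
    · rw [hy (-a) (C.neg_mem ha), AddChar.map_zero_eq_one, mul_one]
    · rw [zero_mul]
  have hcard : (Fintype.card (Fin n → R) : ℂ) ≠ 0 := Nat.cast_ne_zero.2 Fintype.card_ne_zero
  exact hne (mul_left_cancel₀ hcard ((key c₁ h₁ h₁0).trans (key c₂ h₂ h₂0).symm))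

/-- The rows form a union of orbits of the units, without repetition, so that every point has
multiplicity `0` or the size of its orbit. -/
lemma RowsEnumerate.isRightModular {M : Matrix (Fin b) (Fin n) R} {w : ℂ} (hw : w ≠ 0)
    (hM : RowsEnumerate M (weightClass χ (C : Set (Fin n → R)) w)) :
    IsRightModular (colCode M) 1 := by
  have hmem : ∀ i, M i ∈ weightClass χ (C : Set (Fin n → R)) w := fun i => hM.2 ▸ ⟨i, rfl⟩
  refine ⟨fun i => ?_, n, M, rfl, fun h _ => ?_⟩
  · have hi : M i ≠ 0 := fun h => hw (by rw [← (hmem i).2, h, wordWeight_zero])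
    obtain ⟨j, hj⟩ := Function.ne_iff.1 hi
    exact ⟨_, Submodule.subset_span ⟨j, rfl⟩, hj⟩
  · have hmult : rowMult M h = ((fun i => M i) ⁻¹' leftOrbit h).ncard := by
      rw [rowMult, ← Nat.card_coe_set_eq]
      exact Nat.card_congr (Equiv.subtypeEquivRight fun i => span_eq_iff)
    by_cases hne : ∃ i, M i ∈ leftOrbit h
    · right
      obtain ⟨i, u, hu⟩ := hne
      have hu' : (u : R) • h = M i := hu
      have hsub : leftOrbit h ⊆ Set.range fun i => M i := by
        rw [hM.2]
        rintro _ ⟨v, rfl⟩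
        have hv : (fun i => (v : R) * h i) = ((v * u⁻¹ : Rˣ) : R) • M i := by
          rw [← hu', ← mul_smul, ← Units.val_mul, inv_mul_cancel_right]
          rfl
        change (fun i => (v : R) * h i) ∈ _
        rw [hv]
        exact ⟨C.smul_mem _ (hmem i).1, by rw [wordWeight_units_smul]; exact (hmem i).2⟩
      rw [hmult, one_mul, ← Set.ncard_image_of_injective _ hM.1,
        Set.image_preimage_eq_of_subset hsub]
    · left
      push Not at hne
      have : (fun i => M i) ⁻¹' leftOrbit h = ∅ := Set.eq_empty_iff_forall_notMem.2 hne
      rw [hmult, this, Set.ncard_empty]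

end Dual

end FrobCode

open FrobCode Matrix in
theorem mainTheorem2 {R : Type*} [Ring R] [Finite R]
    (χ : AddChar R ℂ) (hχ : FrobCode.IsGeneratingChar χ)
    {n : ℕ} (C : Submodule R (Fin n → R)) (r : ℚ) (hmod : FrobCode.IsLeftModular C r)
    (w₁ w₂ : ℝ) (htwo : FrobCode.IsTwoWeight χ (C : Set (Fin n → R)) w₁ w₂)
    (hC₀ : FrobCode.weightClass χ (C : Set (Fin n → R)) 0 = {0})
    {b₁ : ℕ} (hb₁ : b₁ = (FrobCode.weightClass χ (C : Set (Fin n → R)) w₁).ncard)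
    (M₁ : Matrix (Fin b₁) (Fin n) R)
    (hM₁ : FrobCode.RowsEnumerate M₁ (FrobCode.weightClass χ (C : Set (Fin n → R)) w₁)) :
    FrobCode.IsRightModular (FrobCode.colCode M₁) 1 ∧
    FrobCode.weightClass χ (FrobCode.colCode M₁ : Set (Fin b₁ → R)) 0 = {0} ∧
    FrobCode.IsTwoWeight χ (FrobCode.colCode M₁ : Set (Fin b₁ → R))
      ((b₁ : ℝ) * w₁ / n) ((w₂ - n) * (Nat.card C : ℝ) / (w₂ - w₁)) ∧
    (w₂ - n - (r : ℝ)) * (Nat.card C : ℝ) / (w₂ - w₁) = (b₁ : ℝ) * w₁ / n := by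
  classical
  cases nonempty_fintype R
  obtain ⟨hlt, hset⟩ := htwo
  have hw₁mem : (w₁ : ℂ) ∈ {w : ℂ | w ≠ 0 ∧ ∃ c ∈ (C : Set (Fin n → R)), wordWeight χ c = w} :=
    hset ▸ Set.mem_insert _ _
  have hw₂mem : (w₂ : ℂ) ∈ {w : ℂ | w ≠ 0 ∧ ∃ c ∈ (C : Set (Fin n → R)), wordWeight χ c = w} :=
    hset ▸ Set.mem_insert_of_mem _ rfl
  obtain ⟨hw₁, c₁, hc₁, hc₁w⟩ := hw₁mem
  obtain ⟨hw₂, c₂, hc₂, hc₂w⟩ := hw₂mem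
  have hc₁0 : c₁ ≠ 0 := fun h => hw₁ (by rw [← hc₁w, h, wordWeight_zero])
  have hc₂0 : c₂ ≠ 0 := fun h => hw₂ (by rw [← hc₂w, h, wordWeight_zero])
  have hw₁pos : 0 < w₁ := by
    have h1 := wordWeight_re_nonneg (χ := χ) c₁
    rw [hc₁w, Complex.ofReal_re] at h1
    exact lt_of_le_of_ne h1 fun h => hw₁ (by rw [← h, Complex.ofReal_zero])
  obtain ⟨j₀, -⟩ := Function.ne_iff.1 hc₁0
  have hn : 0 < n := j₀.pos
  have hb : 0 < b₁ := by
    have : c₁ ∈ weightClass χ (C : Set (Fin n → R)) w₁ := ⟨hc₁, hc₁w⟩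
    rw [← hM₁.2] at this
    obtain ⟨i, -⟩ := this
    exact i.pos
  have hC : ∀ c ∈ C, c ≠ 0 → wordWeight χ c = w₁ ∨ wordWeight χ c = w₂ := by
    intro c hc hc0
    have h0 : wordWeight χ c ≠ 0 := fun h => hc0 (by
      have : c ∈ weightClass χ (C : Set (Fin n → R)) 0 := ⟨hc, h⟩
      rwa [hC₀] at this)
    have : wordWeight χ c ∈
        {w : ℂ | w ≠ 0 ∧ ∃ c ∈ (C : Set (Fin n → R)), wordWeight χ c = w} := ⟨h0, c, hc, rfl⟩
    rwa [hset] at this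
  have hU : (0 : ℝ) < Fintype.card Rˣ := Nat.cast_pos.2 Fintype.card_pos
  have hcard : (0 : ℝ) < Nat.card C := Nat.cast_pos.2 Nat.card_pos
  have hcount : ∀ y, coordCount C y = 0 ∨ (coordCount C y : ℝ) = r * Fintype.card Rˣ :=
    fun y => (hmod.coordCount_eq y).imp_right fun h => by exact_mod_cast h
  -- The index is positive because the coordinate functions themselves are covered.
  have hr : (0 : ℝ) < r := by
    have h1 := coordCount_single_ne_zero (C := C) j₀
    have h2 := (hcount (Pi.single j₀ 1)).resolve_left h1
    have h3 : (0 : ℝ) < coordCount C (Pi.single j₀ 1) := Nat.cast_pos.2 (Nat.pos_of_ne_zero h1)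
    rw [h2] at h3
    exact pos_of_mul_pos_left h3 hU.le
  have hd : 0 < w₂ - w₁ := sub_pos.2 hlt
  have hd' : (w₂ : ℂ) - w₁ ≠ 0 := by exact_mod_cast hd.ne'
  set ω₁ : ℝ := (w₂ - n - (r : ℝ)) * (Nat.card C : ℝ) / (w₂ - w₁) with hω₁
  set ω₂ : ℝ := (w₂ - n) * (Nat.card C : ℝ) / (w₂ - w₁) with hω₂
  have hword := fun y => hχ.sum_weightClass_dual hw₁ hC hmod.1 y
  simp only [← hM₁.wordWeight_mulVec, ← Nat.card_eq_fintype_card (α := C)] at hword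
  have hperp : ∀ y, IsPerp C y → M₁ *ᵥ y = 0 := fun y hy => funext fun i =>
    hy _ (hM₁.2.subset ⟨i, rfl⟩ : M₁ i ∈ weightClass χ (C : Set (Fin n → R)) w₁).1
  -- The word `M₁ y` has weight `ω₁` if `y` acts on `C` as a unit multiple of a coordinate function,
  -- and weight `ω₂` if it acts as any other nonzero functional.
  have hval₂ : ∀ y, ¬ IsPerp C y → coordCount C y = 0 → wordWeight χ (M₁ *ᵥ y) = ω₂ := by
    intro y hy h0
    have := hword y
    rw [if_neg hy, h0] at this
    rw [hω₂]
    push_cast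
    rw [eq_div_iff hd', mul_comm, this]
    simp
  have hval₁ : ∀ y, coordCount C y ≠ 0 → wordWeight χ (M₁ *ᵥ y) = ω₁ := by
    intro y h0
    have h2 : (coordCount C y : ℂ) = r * Fintype.card Rˣ := by
      exact_mod_cast (hmod.coordCount_eq y).resolve_left h0
    have := hword y
    rw [if_neg fun h => h0 (coordCount_eq_zero_of_isPerp hmod.1 h), h2,
      mul_div_cancel_right₀ _ card_units_ne_zero] at this
    rw [hω₁]
    push_cast
    rw [eq_div_iff hd', mul_comm, this]
    ring
  -- The sum of the weights of all entries of `M₁`, taken by columns and by rows.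
  have hsum : (n : ℝ) * ω₁ = b₁ * w₁ := by
    have h1 : ∑ j : Fin n, wordWeight χ (M₁ *ᵥ Pi.single j 1) = n * ω₁ := by
      simp only [hval₁ _ (coordCount_single_ne_zero _)]
      simp
    have h2 : ∑ j : Fin n, wordWeight χ (M₁ *ᵥ Pi.single j 1) = b₁ * w₁ := by
      have h3 : ∀ i, ∑ j, homWeight χ (M₁ i j) = w₁ := fun i =>
        (hM₁.2.subset ⟨i, rfl⟩ : M₁ i ∈ weightClass χ (C : Set (Fin n → R)) w₁).2
      simp only [wordWeight, mulVec_single_one]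
      rw [Finset.sum_comm]
      simp [Matrix.col, h3]
    exact_mod_cast h1.symm.trans h2
  have hn' : (0 : ℝ) < n := Nat.cast_pos.2 hn
  have hω₁' : ω₁ = b₁ * w₁ / n := by rw [eq_div_iff hn'.ne', mul_comm, hsum]
  have hω₁pos : 0 < ω₁ := by
    rw [hω₁']
    have : (0 : ℝ) < b₁ := Nat.cast_pos.2 hb
    positivity
  have hω : ω₁ < ω₂ := by
    rw [hω₁, hω₂, div_lt_div_iff_of_pos_right hd]
    exact mul_lt_mul_of_pos_right (by linarith) hcard
  have hω₁0 : (ω₁ : ℂ) ≠ 0 := by exact_mod_cast hω₁pos.ne'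
  have hω₂0 : (ω₂ : ℂ) ≠ 0 := by exact_mod_cast (hω₁pos.trans hω).ne'
  have hcases : ∀ y, M₁ *ᵥ y = 0 ∨ wordWeight χ (M₁ *ᵥ y) = ω₁ ∨
      wordWeight χ (M₁ *ᵥ y) = ω₂ := by
    intro y
    by_cases hy : IsPerp C y
    · exact Or.inl (hperp y hy)
    · by_cases h0 : coordCount C y = 0
      · exact Or.inr (Or.inr (hval₂ y hy h0))
      · exact Or.inr (Or.inl (hval₁ y h0))
  refine ⟨hM₁.isRightModular hw₁, ?_, ?_, hω₁'⟩
  · ext v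
    constructor
    · rintro ⟨hv, hv0⟩
      obtain ⟨y, rfl⟩ := mem_colCode.1 hv
      rcases hcases y with h | h | h
      · exact h
      · exact absurd (h.symm.trans hv0) hω₁0
      · exact absurd (h.symm.trans hv0) hω₂0
    · rintro rfl
      exact ⟨Submodule.zero_mem _, wordWeight_zero⟩
  · rw [← hω₁']
    refine ⟨hω, Set.eq_of_subset_of_subset ?_ ?_⟩
    · rintro w ⟨hw, v, hv, rfl⟩
      obtain ⟨y, rfl⟩ := mem_colCode.1 hv
      rcases hcases y with h | h | h
      · exact absurd (by rw [h, wordWeight_zero]) hw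
      · exact Or.inl h
      · exact Or.inr h
    · rintro w (rfl | rfl)
      · exact ⟨hω₁0, _, mem_colCode.2 ⟨_, rfl⟩, hval₁ _ (coordCount_single_ne_zero j₀)⟩
      · obtain ⟨y, hy, h0⟩ := hχ.exists_coordCount_eq_zero hmod hc₁ hc₂ hc₁0 hc₂0 (by
          rw [hc₁w, hc₂w]
          exact_mod_cast hlt.ne)
        exact ⟨hω₂0, _, mem_colCode.2 ⟨y, rfl⟩, hval₂ y hy h0⟩
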